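/- Let $k$ be a field of characteristic different from $2$, let $c$ be a positive integer, and let $\Lambda = k\langle x_1,\dots,x_c\rangle/(x_i^2,\ x_ix_j+x_jx_i)$ be the exterior algebra over $k$ in $c$ indeterminates. Let $C_2=\{e,h\}$ be the group of order two, acting on $\Lambda$ by algebra automorphisms with ${}^h x_i=-x_i$ for all $i$, and let $A=\Lambda\rtimes C_2$ be the skew group algebra. Let $k$ also denote the trivial $A$-module, on which each $x_i$ acts as zero and $h$ acts as the identity. For $\lambda=(\lambda_1,\dots,\lambda_c)\in k^c$ put $u_\lambda=\lambda_1x_1+\cdots+\lambda_cx_c\in\Lambda\subseteq A$, let $k[u_\lambda]\subseteq A$ be the $k$-subalgebra generated by $u_\lambda$, and let $$\tau_\lambda\colon \operatorname{Ext}_A^{2*}(k,k)\longrightarrow \operatorname{Ext}_{k[u_\lambda]}^{2*}(k,k)$$ be the homomorphism of even-degree cohomology rings (with the Yoneda product) given by restriction along the inclusion $k[u_\lambda]\to A$. Let $\mathfrak m_0$ be the ideal of $\operatorname{Ext}_A^{2*}(k,k)$ generated by the homogeneous elements of positive degree; it is the unique graded maximal ideal of this ring. For every nonzero $\lambda\in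 k^c$, the kernel $\operatorname{Ker}\tau_\lambda$ is a graded prime ideal of $\operatorname{Ext}_A^{2*}(k,k)$, different from $\mathfrak m_0$. Moreover, if $\lambda$ and $\mu$ are nonzero tuples in $k^c$, then $\operatorname{Ker}\tau_\lambda=\operatorname{Ker}\tau_\mu$ if and only if $\mu=\alpha\lambda$ for some (necessarily nonzero) scalar $\alpha\in k$. -/

import Mathlib

open CategoryTheory CategoryTheory.Abelian CategoryTheory.Limits

universe u v w u' v' w'

noncomputable section

/-! ### The even Yoneda ring of an object of an abelian category -/

section EvenExt

variable {C : Type u} [Category.{v} C] [Abelian C] [HasExt.{w} C]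

/-- The group `Ext^{2n}(X, X)`. -/
def EvenExtPiece (X : C) (n : ℕ) : Type w := Ext.{w} X X (2 * n)

instance (X : C) (n : ℕ) : AddCommGroup (EvenExtPiece X n) :=
  inferInstanceAs (AddCommGroup (Ext.{w} X X (2 * n)))

/-- The Yoneda product `η ∘ θ` (first `θ`, then `η`; `Ext.comp` is in diagrammatic order). -/
def EvenExtPiece.yoneda {X : C} {m n : ℕ} (η : EvenExtPiece X m) (θ : EvenExtPiece X n) :
    EvenExtPiece X (m + n) :=
  Ext.comp (a := 2 * n) (b := 2 * m) θ η (by ring)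

/-- The identity of `X`, as an element of `Ext⁰(X, X)`. -/
def EvenExtPiece.one (X : C) : EvenExtPiece X 0 := (Ext.mk₀ (𝟙 X) : Ext X X 0)

instance (X : C) : GradedMonoid.GMul (EvenExtPiece X) := ⟨EvenExtPiece.yoneda⟩

instance (X : C) : GradedMonoid.GOne (EvenExtPiece X) := ⟨EvenExtPiece.one X⟩

lemma EvenExtPiece.sigma_ext {X : C} {m n : ℕ} (h : m = n) (x : Ext.{w} X X (2 * m))
    (y : Ext.{w} X X (2 * n)) (hxy : HEq x y) :
    (⟨m, x⟩ : GradedMonoid (EvenExtPiece X)) = ⟨n, y⟩ := by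
  subst h
  exact congrArg (Sigma.mk m) (eq_of_heq hxy)

lemma EvenExtPiece.comp_id_heq {X : C} {a c : ℕ} (α : Ext.{w} X X a) (h : a + 0 = c) :
    HEq (α.comp (Ext.mk₀ (𝟙 X)) h) α := by
  subst h
  exact heq_of_eq (Ext.comp_mk₀_id α)

lemma EvenExtPiece.id_comp_heq {X : C} {a c : ℕ} (α : Ext.{w} X X a) (h : 0 + a = c) :
    HEq ((Ext.mk₀ (𝟙 X)).comp α h) α := by
  obtain rfl : a = c := by omega
  exact heq_of_eq (Ext.mk₀_id_comp α)

lemma EvenExtPiece.comp_assoc_heq {X : C} {a b c ab bc d d' : ℕ} (α : Ext.{w} X X a)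
    (β : Ext.{w} X X b) (γ : Ext.{w} X X c) (h₁ : a + b = ab) (h₂ : b + c = bc)
    (h : a + bc = d) (h' : ab + c = d') :
    HEq (α.comp (β.comp γ h₂) h) ((α.comp β h₁).comp γ h') := by
  obtain rfl : d = d' := by omega
  exact heq_of_eq (Ext.comp_assoc α β γ h₁ h₂ (by omega)).symm

lemma EvenExtPiece.two_mul_add (i j : ℕ) : 2 * j + 2 * i = 2 * (i + j) := by ring

instance (X : C) : DirectSum.GRing (EvenExtPiece X) where
  mul_zero {i j} η := Ext.zero_comp (X := X) (Y := X) (Z := X) (n := 2 * j) (m := 2 * i) η _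
    (EvenExtPiece.two_mul_add i j)
  zero_mul {i j} θ := Ext.comp_zero (X := X) (Y := X) (n := 2 * j) θ X (2 * i) _
    (EvenExtPiece.two_mul_add i j)
  mul_add {i j} η θ θ' := Ext.add_comp (X := X) (Y := X) (Z := X) (n := 2 * j) (m := 2 * i)
    θ θ' η (EvenExtPiece.two_mul_add i j)
  add_mul {i j} η η' θ := Ext.comp_add (X := X) (Y := X) (Z := X) (n := 2 * j) (m := 2 * i)
    θ η η' (EvenExtPiece.two_mul_add i j)
  one_mul := fun ⟨n, x⟩ => EvenExtPiece.sigma_ext (zero_add n) _ _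
    (EvenExtPiece.comp_id_heq (a := 2 * n) x (EvenExtPiece.two_mul_add 0 n))
  mul_one := fun ⟨n, x⟩ => EvenExtPiece.sigma_ext (add_zero n) _ _
    (EvenExtPiece.id_comp_heq (a := 2 * n) x (EvenExtPiece.two_mul_add n 0))
  mul_assoc := fun ⟨l, x⟩ ⟨m, y⟩ ⟨n, z⟩ => EvenExtPiece.sigma_ext (add_assoc l m n) _ _
    (EvenExtPiece.comp_assoc_heq (a := 2 * n) (b := 2 * m) (c := 2 * l) z y x
      (EvenExtPiece.two_mul_add m n) (EvenExtPiece.two_mul_add l m)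
      (EvenExtPiece.two_mul_add (l + m) n) (EvenExtPiece.two_mul_add l (m + n)))
  natCast n := n • EvenExtPiece.one X
  natCast_zero := zero_nsmul _
  natCast_succ n := succ_nsmul _ _
  intCast n := n • EvenExtPiece.one X
  intCast_ofNat n := natCast_zsmul _ _
  intCast_negSucc_ofNat n := negSucc_zsmul _ _

/-- The even Ext ring `Ext^{2*}(X, X) = ⨁ₙ Ext^{2n}(X, X)` with the Yoneda product. -/
abbrev EvenExt (X : C) : Type w := DirectSum ℕ (EvenExtPiece X)

/-- The subgroup of `Ext^{2*}(X, X)` of homogeneous elements of degree `2n`. -/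
def EvenExt.grading (X : C) (n : ℕ) : AddSubgroup (EvenExt X) :=
  (DirectSum.of (EvenExtPiece X) n).range

/-- The inclusion of a homogeneous piece, as a map to the corresponding subgroup. -/
def EvenExt.ofPiece (X : C) (n : ℕ) : EvenExtPiece X n →+ EvenExt.grading X n :=
  (DirectSum.of (EvenExtPiece X) n).rangeRestrict

instance (X : C) : GradedRing (EvenExt.grading X) where
  one_mem := ⟨EvenExtPiece.one X, rfl⟩
  mul_mem := by
    rintro i j _ _ ⟨x, rfl⟩ ⟨y, rfl⟩
    exact ⟨EvenExtPiece.yoneda x y, (DirectSum.of_mul_of x y).symm⟩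
  decompose' := DirectSum.toAddMonoid fun n =>
    (DirectSum.of (fun i => EvenExt.grading X i) n).comp (EvenExt.ofPiece X n)
  left_inv x := by
    induction x using DirectSum.induction_on with
    | zero => simp only [map_zero]
    | of i x =>
      rw [DirectSum.toAddMonoid_of, AddMonoidHom.comp_apply, DirectSum.coeAddMonoidHom_of]
      rfl
    | add x y hx hy => rw [map_add, map_add, hx, hy]
  right_inv x := by
    induction x using DirectSum.induction_on with
    | zero => simp only [map_zero]
    | of i x =>
      obtain ⟨_, x, rfl⟩ := x
      rw [DirectSum.coeAddMonoidHom_of, DirectSum.toAddMonoid_of]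
      rfl
    | add x y hx hy => rw [map_add, map_add, hx, hy]

variable {D : Type u'} [Category.{v'} D] [Abelian D] [HasExt.{w'} D]

/-- The map `Ext^{2n}(X, X) → Ext^{2n}(F X, F X)` induced by an exact functor `F`. -/
def EvenExtPiece.map (F : C ⥤ D) [F.Additive] [PreservesFiniteLimits F]
    [PreservesFiniteColimits F] (X : C) (n : ℕ) : EvenExtPiece X n →+ EvenExtPiece (F.obj X) n :=
  F.mapExtAddHom X X (2 * n)

/-- The ring homomorphism `Ext^{2*}(X, X) → Ext^{2*}(F X, F X)` induced by an exact functor `F`. -/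
def EvenExt.map (F : C ⥤ D) [F.Additive] [PreservesFiniteLimits F] [PreservesFiniteColimits F]
    (X : C) : EvenExt X →+* EvenExt (F.obj X) :=
  DirectSum.toSemiring
    (fun n => (DirectSum.of (EvenExtPiece (F.obj X)) n).comp (EvenExtPiece.map F X n))
    (by
      have h : EvenExtPiece.map F X 0 (EvenExtPiece.one X) = EvenExtPiece.one (F.obj X) :=
        (Ext.mapExactFunctor_mk₀ F (𝟙 X)).trans (congrArg Ext.mk₀ (F.map_id X))
      exact congrArg (DirectSum.of (EvenExtPiece (F.obj X)) 0) h)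
    (by
      intro m n η θ
      have h : EvenExtPiece.map F X (m + n) (η.yoneda θ) =
          (EvenExtPiece.map F X m η).yoneda (EvenExtPiece.map F X n θ) :=
        Ext.mapExactFunctor_comp F (X := X) (Y := X) (Z := X) (a := 2 * n) (b := 2 * m) θ η
          (EvenExtPiece.two_mul_add m n)
      exact (congrArg (DirectSum.of (EvenExtPiece (F.obj X)) (m + n)) h).trans
        (DirectSum.of_mul_of _ _).symm)

end EvenExt

/-! ### The skew group algebra of an exterior algebra -/

section SkewExterior

variable (k : Type u) [Field k] (c : ℕ)

/-- The exterior algebra over `k` in the indeterminates `x₁, …, x_c`. -/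
abbrev Lam : Type u := ExteriorAlgebra k (Fin c → k)

/-- The indeterminate `xᵢ`. -/
def Lam.x (i : Fin c) : Lam k c := ExteriorAlgebra.ι k (Pi.single i 1)

/-- The group `C₂ = {e, h}` of order two, written multiplicatively. -/
abbrev C₂ : Type := Multiplicative (ZMod 2)

/-- The generator of `C₂`. -/
def C₂.h : C₂ := Multiplicative.ofAdd 1

/-- The homomorphism from `C₂` to the algebra automorphisms of the exterior algebra that sends the
generator to the automorphism with `xᵢ ↦ -xᵢ` for all `i`. -/
def C₂.toAut : C₂ →* (Lam k c ≃ₐ[k] Lam k c) where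
  toFun g := if g = 1 then 1 else CliffordAlgebra.involuteEquiv
  map_one' := by simp
  map_mul' := by
    have hi : (CliffordAlgebra.involuteEquiv : Lam k c ≃ₐ[k] Lam k c) *
        CliffordAlgebra.involuteEquiv = 1 := by
      ext x
      exact CliffordAlgebra.involute_involute x
    have hg : ∀ g : C₂, g = 1 ∨ g = C₂.h := by decide
    have h1 : C₂.h ≠ 1 := by decide
    have h2 : C₂.h * C₂.h = 1 := by decide
    intro a b
    rcases hg a with rfl | rfl <;> rcases hg b with rfl | rfl <;> simp [h1, h2, hi]

instance : MulSemiringAction C₂ (Lam k c) := MulSemiringAction.compHom _ (C₂.toAut k c)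

lemma C₂.h_smul_x (i : Fin c) : C₂.h • Lam.x k c i = -Lam.x k c i := by
  have h1 : C₂.h ≠ 1 := by decide
  have : C₂.toAut k c C₂.h (Lam.x k c i) = -Lam.x k c i := by
    simp only [C₂.toAut, MonoidHom.coe_mk, OneHom.coe_mk, if_neg h1]
    exact CliffordAlgebra.involute_ι _
  exact this

instance : SMulCommClass C₂ k (Lam k c) :=
  ⟨fun g a x => map_smul (C₂.toAut k c g) a x⟩

/-- The skew group algebra `A = Λ ⋊ C₂`; the element `w ⊗ g` is `SkewMonoidAlgebra.single g w`. -/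
abbrev SkewExt : Type u := SkewMonoidAlgebra (Lam k c) C₂

lemma SkewExt.augmentation_smul (g : C₂) (w : Lam k c) :
    ExteriorAlgebra.algebraMapInv (g • w) = ExteriorAlgebra.algebraMapInv w := by
  have hi : ExteriorAlgebra.algebraMapInv.comp (C₂.toAut k c g : Lam k c →ₐ[k] Lam k c) =
      ExteriorAlgebra.algebraMapInv := by
    apply ExteriorAlgebra.hom_ext
    ext i
    by_cases hg : g = 1
    · simp [C₂.toAut, hg]
    · simp [C₂.toAut, hg, ExteriorAlgebra.algebraMapInv]
  exact DFunLike.congr_fun hi w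

/-- The counit `ε : A → k`, with `ε (xᵢ) = 0` and `ε (h) = 1`. -/
def SkewExt.counit : SkewExt k c →ₐ[k] k :=
  SkewMonoidAlgebra.liftNCAlgHom ExteriorAlgebra.algebraMapInv (1 : C₂ →* k) (by
    intro w g
    simp [SkewExt.augmentation_smul])

lemma SkewExt.counit_single (g : C₂) (w : Lam k c) :
    SkewExt.counit k c (SkewMonoidAlgebra.single g w) = ExteriorAlgebra.algebraMapInv w := by
  simp [SkewExt.counit, SkewMonoidAlgebra.liftNCAlgHom, SkewMonoidAlgebra.liftNCRingHom]

variable {c}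

/-- The element `u_λ ⊗ e` of `A`, where `u_λ = λ₁x₁ + ⋯ + λ_cx_c`. -/
def SkewExt.u (l : Fin c → k) : SkewExt k c :=
  SkewMonoidAlgebra.single 1 (∑ i, l i • Lam.x k c i)

/-- The subalgebra `k[u_λ]` of `A`. -/
abbrev SkewExt.ku (l : Fin c → k) : Subalgebra k (SkewExt k c) := Algebra.adjoin k {SkewExt.u k l}

variable (c)

/-- The trivial `A`-module `k`. -/
def SkewExt.triv : ModuleCat.{u} (SkewExt k c) :=
  (ModuleCat.restrictScalars (SkewExt.counit k c).toRingHom).obj (ModuleCat.of k k)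

variable {c}

/-- Restriction of `A`-modules to `k[u_λ]`. -/
abbrev SkewExt.res (l : Fin c → k) : ModuleCat.{u} (SkewExt k c) ⥤ ModuleCat.{u} (SkewExt.ku k l) :=
  ModuleCat.restrictScalars (SkewExt.ku k l).val.toRingHom

instance (l : Fin c → k) : PreservesFiniteLimits (SkewExt.res k l) where
  preservesFiniteLimits _ := { preservesLimit := inferInstance }

instance (l : Fin c → k) : PreservesFiniteColimits (SkewExt.res k l) where
  preservesFiniteColimits _ := { preservesColimit := inferInstance }

/-- The restriction map `τ_λ : Ext_A^{2*}(k, k) → Ext_{k[u_λ]}^{2*}(k, k)`. -/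
def SkewExt.tau (l : Fin c → k) :
    EvenExt (SkewExt.triv k c) →+* EvenExt ((SkewExt.res k l).obj (SkewExt.triv k c)) :=
  EvenExt.map (SkewExt.res k l) (SkewExt.triv k c)

end SkewExterior

end

noncomputable section

/-! ### Direct sums without homogeneous zero divisors -/

/-! No computation of the whole ring `Ext_A^{2*}(k, k)` is needed: one class of degree two for each
linear form `ℓ` on `k^c` suffices. Let `Λ` act on the dual numbers through `v ↦ ℓ(v) ε`, and let
`C₂` act by a character on the top and by that character times the sign on the line of `ε`. The
resulting extensions of `k` by the sign module and of the sign module by `k` splice to a class in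
`Ext²_A(k, k)`, which plays the role of `ℓ²`.

On these modules `u_λ` acts as multiplication by `ℓ(λ) ε`. If `ℓ(λ) = 0`, the first extension splits
over `k[u_λ]`, so the class restricts to zero. If `ℓ(λ) ≠ 0`, both middle terms become free of rank
one over `k[u_λ]`, and multiplication by the restricted class is a periodicity isomorphism. Hence
the class lies in `Ker τ_λ` exactly when `ℓ(λ) = 0` (`SkewExt.square_mem_ker_tau_iff`).

Periodicity also reduces a product of homogeneous elements of the target to degree zero, where
nonzero endomorphisms of the one-dimensional module are invertible. So the target has no zero
divisors and `Ker τ_λ` is prime; it is graded because `τ_λ` is, and a coordinate form with `λ_i ≠ 0`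
shows that it is neither the whole ring nor `m₀`. If `μ` is not on the line of `λ`, a form killing
`λ` but not `μ` separates the kernels; proportional nonzero tuples generate the same subalgebra. -/

lemma DirectSum.mul_ne_zero_of_homogeneous {A : ℕ → Type*} [∀ i, AddCommGroup (A i)]
    [DirectSum.GSemiring A]
    (h : ∀ (i j : ℕ) (a : A i) (b : A j), a ≠ 0 → b ≠ 0 →
      (GradedMonoid.GMul.mul a b : A (i + j)) ≠ 0)
    {x y : DirectSum ℕ A} (hx : x ≠ 0) (hy : y ≠ 0) : x * y ≠ 0 := by
  classical
  have hx' : x.support.Nonempty := by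
    rw [Finset.nonempty_iff_ne_empty, Ne, DFinsupp.support_eq_empty]
    exact hx
  have hy' : y.support.Nonempty := by
    rw [Finset.nonempty_iff_ne_empty, Ne, DFinsupp.support_eq_empty]
    exact hy
  set p := x.support.max' hx'
  set q := y.support.max' hy'
  have hp : p ∈ x.support := Finset.max'_mem _ _
  have hq : q ∈ y.support := Finset.max'_mem _ _
  -- Compare top components: with `i ≤ p` and `j ≤ q`, only the pair `(p, q)` contributes to degree
  -- `p + q`.
  have key : (x * y) (p + q) = GradedMonoid.GMul.mul (x p) (y q) := by
    rw [DirectSum.mul_eq_sum_support_ghas_mul, DFinsupp.finsetSum_apply,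
      Finset.sum_eq_single (p, q)]
    · exact DirectSum.of_eq_same _ _
    · rintro ⟨i, j⟩ hij hne
      rw [Finset.mem_product] at hij
      have hi : i ≤ p := Finset.le_max' _ _ hij.1
      have hj : j ≤ q := Finset.le_max' _ _ hij.2
      refine DirectSum.of_eq_of_ne _ _ _ fun hs => hne ?_
      ext <;> dsimp only at * <;> omega
    · exact fun hn => absurd (Finset.mem_product.2 ⟨hp, hq⟩) hn
  intro h0
  rw [h0] at key
  exact h p q _ _ (DFinsupp.mem_support_iff.1 hp) (DFinsupp.mem_support_iff.1 hq) key.symm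

/-! ### Dimension shifting along a two-step extension with projective middle terms -/

section Shift

variable {C : Type u} [Category.{v} C] [Abelian C] [HasExt.{w} C]

lemma CategoryTheory.ShortComplex.ShortExact.exists_extClass_comp {S : ShortComplex C}
    (hS : S.ShortExact) [Projective S.X₂] {Y : C} {n m : ℕ} (h : 1 + n = m)
    (z : Ext.{w} S.X₃ Y m) : ∃ x : Ext.{w} S.X₁ Y n, hS.extClass.comp x h = z := by
  obtain rfl : m = n + 1 := by omega
  exact Ext.contravariant_sequence_exact₃ hS Y z (Ext.eq_zero_of_projective _) h

lemma CategoryTheory.ShortComplex.ShortExact.eq_zero_of_extClass_comp_pos {S : ShortComplex C}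
    (hS : S.ShortExact) [Projective S.X₂] {Y : C} {n m : ℕ} (h : 1 + (n + 1) = m)
    (x : Ext.{w} S.X₁ Y (n + 1)) (hx : hS.extClass.comp x h = 0) : x = 0 := by
  obtain ⟨z, rfl⟩ := Ext.contravariant_sequence_exact₁ hS Y x h hx
  rw [Ext.eq_zero_of_projective z, Ext.comp_zero]

/-- In degree zero the kernel of the connecting map consists of the maps that extend over `S.X₂`;
`hY` says that these all vanish. Higher degrees need only projectivity. -/
lemma CategoryTheory.ShortComplex.ShortExact.eq_zero_of_extClass_comp {S : ShortComplex C}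
    (hS : S.ShortExact) [Projective S.X₂] {Y : C} (hY : ∀ g : S.X₂ ⟶ Y, S.f ≫ g = 0) {n m : ℕ}
    (h : 1 + n = m) (x : Ext.{w} S.X₁ Y n) (hx : hS.extClass.comp x h = 0) : x = 0 := by
  cases n with
  | zero =>
    obtain ⟨z, rfl⟩ := Ext.contravariant_sequence_exact₁ hS Y x h hx
    obtain ⟨g, rfl⟩ := (Ext.mk₀_bijective _ _).2 z
    rw [Ext.mk₀_comp_mk₀, hY, Ext.mk₀_zero]
  | succ n => exact hS.eq_zero_of_extClass_comp_pos h x hx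

/-- The identity factors through `S.g`, and pulling the class back along `S.g` gives zero. -/
lemma CategoryTheory.ShortComplex.ShortExact.extClass_eq_zero_of_section {S : ShortComplex C}
    (hS : S.ShortExact) (s : S.X₃ ⟶ S.X₂) (hs : s ≫ S.g = 𝟙 _) :
    (hS.extClass : Ext.{w} S.X₃ S.X₁ 1) = 0 := by
  rw [← Ext.mk₀_id_comp hS.extClass, ← hs, ← Ext.mk₀_comp_mk₀,
    Ext.comp_assoc _ _ _ (zero_add 0) (zero_add 1) (by omega), hS.comp_extClass, Ext.comp_zero]

variable {T T' E E' : C} {f : T' ⟶ E} {g : E ⟶ T} {w₁ : f ≫ g = 0}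
  {f' : T ⟶ E'} {g' : E' ⟶ T'} {w₂ : f' ≫ g' = 0}

/-- The Yoneda product of the classes of two short exact sequences `0 → T' → E → T → 0` and
`0 → T → E' → T' → 0`. -/
def twoStepClass (h₁ : (ShortComplex.mk f g w₁).ShortExact)
    (h₂ : (ShortComplex.mk f' g' w₂).ShortExact) : Ext.{w} T T 2 :=
  Ext.comp (X := T) (Y := T') (Z := T) h₁.extClass h₂.extClass (by omega : 1 + 1 = 2)

variable (h₁ : (ShortComplex.mk f g w₁).ShortExact) (h₂ : (ShortComplex.mk f' g' w₂).ShortExact)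

lemma twoStepClass_comp {Y : C} {n m : ℕ} (x : Ext.{w} T Y n) (h : 2 + n = m) :
    (twoStepClass h₁ h₂).comp x h =
      Ext.comp (X := T) (Y := T') (Z := Y) h₁.extClass
        (Ext.comp (X := T') (Y := T) (Z := Y) h₂.extClass x (rfl : 1 + n = 1 + n)) (by omega) :=
  Ext.comp_assoc (X := T) (Y := T') (Z := T) (T := Y) h₁.extClass h₂.extClass x _ _ (by omega)

lemma twoStepClass_eq_zero_of_section (s : T ⟶ E) (hs : s ≫ g = 𝟙 T) :
    (twoStepClass h₁ h₂ : Ext.{w} T T 2) = 0 :=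
  (congrArg (fun a => Ext.comp (X := T) (Y := T') (Z := T) a h₂.extClass (by omega : 1 + 1 = 2))
    (h₁.extClass_eq_zero_of_section s hs)).trans (Ext.zero_comp _ _ _ _ _)

/-- Surjective half of periodicity: both connecting maps are onto because the middle terms have no
higher `Ext`. -/
lemma exists_twoStepClass_comp [Projective E] [Projective E'] {Y : C} {n m : ℕ} (h : 2 + n = m)
    (z : Ext.{w} T Y m) : ∃ x : Ext.{w} T Y n, (twoStepClass h₁ h₂).comp x h = z := by
  have : Projective (ShortComplex.mk f g w₁).X₂ := ‹Projective E›
  have : Projective (ShortComplex.mk f' g' w₂).X₂ := ‹Projective E'›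
  obtain ⟨y, rfl⟩ := h₁.exists_extClass_comp (n := 1 + n) (by omega) z
  obtain ⟨x, rfl⟩ := h₂.exists_extClass_comp (n := n) rfl y
  exact ⟨x, twoStepClass_comp h₁ h₂ x h⟩

/-- Injective half of periodicity. A condition on degree-zero maps is needed only for the second
sequence, since the first is applied in degree `1 + n > 0`. -/
lemma eq_zero_of_twoStepClass_comp [Projective E] [Projective E'] {Y : C}
    (hY : ∀ a : E' ⟶ Y, f' ≫ a = 0) {n m : ℕ} (h : 2 + n = m)
    (x : Ext.{w} T Y n) (hx : (twoStepClass h₁ h₂).comp x h = 0) : x = 0 := by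
  have : Projective (ShortComplex.mk f g w₁).X₂ := ‹Projective E›
  have : Projective (ShortComplex.mk f' g' w₂).X₂ := ‹Projective E'›
  rw [twoStepClass_comp] at hx
  refine h₂.eq_zero_of_extClass_comp hY rfl x ?_
  -- The degree is generalized because `1 + n` is not literally a successor.
  have key : ∀ (p : ℕ) (hp : 1 + p = m) (y : Ext.{w} T' Y p), p ≠ 0 →
      Ext.comp (X := T) (Y := T') (Z := Y) h₁.extClass y hp = 0 → y = 0 := by
    rintro (_ | p) hp y hp0 hy
    · exact absurd rfl hp0
    · exact h₁.eq_zero_of_extClass_comp_pos hp y hy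
  exact key _ _ _ (by omega) hx

/-- The class is the periodicity image of the identity of `T`, and periodicity is injective. -/
lemma twoStepClass_ne_zero (hE : Projective E) (hE' : Projective E') (hT : ∀ a : E' ⟶ T, f' ≫ a = 0)
    (hid : 𝟙 T ≠ 0) : (twoStepClass h₁ h₂ : Ext.{w} T T 2) ≠ 0 := by
  intro h0
  have h := eq_zero_of_twoStepClass_comp h₁ h₂ hT (n := 0) rfl (Ext.mk₀ (𝟙 T) : Ext.{w} T T 0)
    (by rw [h0, Ext.zero_comp])
  exact hid ((Ext.mk₀_bijective T T).1 (h.trans (Ext.mk₀_zero _ _).symm))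

include h₁ h₂ in
-- Induction on `n`: strip one periodicity class off the left factor until it has degree zero, where
-- it is an isomorphism by `hiso`.
lemma comp_ne_zero_of_twoStep [Projective E] [Projective E']
    (hT : ∀ a : E' ⟶ T, f' ≫ a = 0) (hiso : ∀ a : T ⟶ T, a ≠ 0 → IsIso a) (n : ℕ) :
    ∀ {i j m : ℕ} (_ : i = 2 * n) (h : i + j = m) (x : Ext.{w} T T i) (y : Ext.{w} T T j),
      x ≠ 0 → y ≠ 0 → x.comp y h ≠ 0 := by
  induction n with
  | zero =>
    intro i j m hi h x y hx hy hxy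
    obtain rfl : i = 0 := by omega
    obtain rfl : j = m := by omega
    obtain ⟨a, rfl⟩ := (Ext.mk₀_bijective _ _).2 x
    have : IsIso a := hiso a fun h0 => hx (by rw [h0, Ext.mk₀_zero])
    apply hy
    rw [← Ext.mk₀_id_comp y, ← IsIso.inv_hom_id a, ← Ext.mk₀_comp_mk₀,
      Ext.comp_assoc _ _ _ (zero_add 0) (zero_add _) (by omega), hxy, Ext.comp_zero]
  | succ n ih =>
    intro i j m hi h x y hx hy hxy
    obtain ⟨x, rfl⟩ := exists_twoStepClass_comp h₁ h₂ (n := 2 * n) (by omega) x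
    have hx' : x ≠ 0 := fun h0 => hx (by rw [h0, Ext.comp_zero])
    rw [Ext.comp_assoc _ _ _ (by omega) (rfl : 2 * n + j = 2 * n + j) (by omega)] at hxy
    exact ih rfl rfl x y hx' hy (eq_zero_of_twoStepClass_comp h₁ h₂ hT _ _ hxy)

include h₁ h₂ in
lemma EvenExt.mul_ne_zero_of_twoStep (hE : Projective E) (hE' : Projective E')
    (hT : ∀ a : E' ⟶ T, f' ≫ a = 0) (hiso : ∀ a : T ⟶ T, a ≠ 0 → IsIso a)
    {x y : EvenExt.{u, v, w} T} (hx : x ≠ 0) (hy : y ≠ 0) : x * y ≠ 0 :=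
  DirectSum.mul_ne_zero_of_homogeneous (A := EvenExtPiece T)
    (fun i j (a : Ext.{w} T T (2 * i)) b ha hb =>
    -- The Yoneda product `a * b` is `b.comp a`, so `b`, of degree `2 * j`, is the factor to be
    -- stripped.
    comp_ne_zero_of_twoStep h₁ h₂ hT hiso j rfl (EvenExtPiece.two_mul_add i j) b a hb ha) hx hy

end Shift

/-! ### The kernel of the map induced by an exact functor -/

section Kernel

variable {C : Type u} [Category.{v} C] [Abelian C] [HasExt.{w} C]
  {D : Type u'} [Category.{v'} D] [Abelian D] [HasExt.{w'} D]
  (F : C ⥤ D) [F.Additive] [PreservesFiniteLimits F] [PreservesFiniteColimits F] (X : C)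

lemma EvenExt.map_of (n : ℕ) (a : EvenExtPiece X n) :
    EvenExt.map F X (DirectSum.of _ n a) = DirectSum.of _ n (EvenExtPiece.map F X n a) :=
  DirectSum.toSemiring_of _ _ _ n a

lemma EvenExt.map_apply (x : EvenExt X) (n : ℕ) :
    EvenExt.map F X x n = EvenExtPiece.map F X n (x n) := by
  induction x using DirectSum.induction_on with
  | zero => simp
  | of i a =>
    rw [EvenExt.map_of]
    by_cases h : i = n
    · subst h
      rw [DirectSum.of_eq_same, DirectSum.of_eq_same]
    · rw [DirectSum.of_eq_of_ne _ _ _ (Ne.symm h), DirectSum.of_eq_of_ne _ _ _ (Ne.symm h), map_zero]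
  | add x y hx hy => rw [map_add, DirectSum.add_apply, hx, hy, DirectSum.add_apply, map_add]

lemma EvenExt.decompose_coe (x : EvenExt X) (n : ℕ) :
    (DirectSum.decompose (EvenExt.grading X) x n : EvenExt X) = DirectSum.of _ n (x n) := by
  induction x using DirectSum.induction_on with
  | zero => simp
  | of i a =>
    have hm : DirectSum.of (EvenExtPiece X) i a ∈ EvenExt.grading X i := ⟨a, rfl⟩
    by_cases h : i = n
    · subst h
      rw [DirectSum.decompose_of_mem_same _ hm, DirectSum.of_eq_same]
    · rw [DirectSum.decompose_of_mem_ne _ hm h, DirectSum.of_eq_of_ne _ _ _ (Ne.symm h), map_zero]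
  | add x y hx hy =>
    rw [DirectSum.decompose_add, DirectSum.add_apply, AddSubgroup.coe_add, hx, hy,
      DirectSum.add_apply, map_add]

lemma EvenExt.ker_map_isHomogeneous :
    (RingHom.ker (EvenExt.map F X)).IsHomogeneous (EvenExt.grading X) := by
  intro n x hx
  rw [RingHom.mem_ker] at hx ⊢
  rw [EvenExt.decompose_coe, EvenExt.map_of, ← EvenExt.map_apply, hx, DirectSum.zero_apply, map_zero]

lemma EvenExt.of_mem_ker_map_iff (n : ℕ) (a : EvenExtPiece X n) :
    DirectSum.of _ n a ∈ RingHom.ker (EvenExt.map F X) ↔ EvenExtPiece.map F X n a = 0 := by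
  rw [RingHom.mem_ker, EvenExt.map_of]
  exact map_eq_zero_iff _ (DirectSum.of_injective n)

lemma EvenExt.of_mem_irrelevant {n : ℕ} (hn : n ≠ 0) (a : EvenExtPiece X n) :
    DirectSum.of _ n a ∈ (HomogeneousIdeal.irrelevant (EvenExt.grading X)).toIdeal := by
  rw [HomogeneousIdeal.mem_iff, HomogeneousIdeal.mem_irrelevant_iff, GradedRing.proj_apply,
    EvenExt.decompose_coe, DirectSum.of_eq_of_ne _ _ _ hn.symm, map_zero]

variable {X} {X' Y Y' : C} {f : X' ⟶ Y} {g : Y ⟶ X} {w₁ : f ≫ g = 0}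
  {f' : X ⟶ Y'} {g' : Y' ⟶ X'} {w₂ : f' ≫ g' = 0}

/-- Exact functors preserve Yoneda products and send the class of an extension to the class of its
image. -/
lemma map_twoStepClass (h₁ : (ShortComplex.mk f g w₁).ShortExact)
    (h₂ : (ShortComplex.mk f' g' w₂).ShortExact) :
    (twoStepClass h₁ h₂ : Ext.{w} X X 2).mapExactFunctor F =
      (twoStepClass (w₁ := by rw [← F.map_comp, w₁, F.map_zero])
        (w₂ := by rw [← F.map_comp, w₂, F.map_zero])
        (h₁.map_of_exact F) (h₂.map_of_exact F) : Ext.{w'} (F.obj X) (F.obj X) 2) :=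
  (Ext.mapExactFunctor_comp F (X := X) (Y := X') (Z := X) h₁.extClass h₂.extClass _).trans
    (congrArg₂ (fun a b => Ext.comp (X := F.obj X) (Y := F.obj X') (Z := F.obj X) a b
      (by omega : 1 + 1 = 2))
      (Ext.mapExactFunctor_extClass F h₁) (Ext.mapExactFunctor_extClass F h₂))

end Kernel

/-! ### Two-dimensional modules over the skew group algebra -/

section Modules

lemma C₂.eq_one_or_eq_h (g : C₂) : g = 1 ∨ g = C₂.h := by
  revert g
  decide

lemma C₂.h_ne_one : C₂.h ≠ 1 := by decide

lemma C₂.h_mul_h : C₂.h * C₂.h = 1 := by decide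

variable (k : Type u) [Field k]

/-- The sign character of `C₂`. -/
def C₂.sgn : C₂ →* k where
  toFun g := if g = 1 then 1 else -1
  map_one' := if_pos rfl
  map_mul' a b := by
    rcases C₂.eq_one_or_eq_h a with rfl | rfl <;> rcases C₂.eq_one_or_eq_h b with rfl | rfl <;>
      simp [C₂.h_ne_one, C₂.h_mul_h]

lemma C₂.sgn_mul_self : C₂.sgn k * C₂.sgn k = 1 := by
  refine MonoidHom.ext fun g => ?_
  rcases C₂.eq_one_or_eq_h g with rfl | rfl <;> simp [C₂.sgn, C₂.h_ne_one]

variable {k} {c : ℕ}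

lemma Lam.smul_ι (g : C₂) (v : Fin c → k) :
    g • (ExteriorAlgebra.ι k v : Lam k c) = C₂.sgn k g • ExteriorAlgebra.ι k v := by
  change C₂.toAut k c g (ExteriorAlgebra.ι k v) = _
  rcases C₂.eq_one_or_eq_h g with rfl | rfl
  · simp
  · simp only [C₂.toAut, C₂.sgn, MonoidHom.coe_mk, OneHom.coe_mk, if_neg C₂.h_ne_one, neg_smul,
      one_smul]
    exact CliffordAlgebra.involute_ι _

/-- The character of `A` that is the augmentation on `Λ` and `σ` on `C₂`. -/
def SkewExt.char (σ : C₂ →* k) : SkewExt k c →ₐ[k] k :=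
  SkewMonoidAlgebra.liftNCAlgHom ExteriorAlgebra.algebraMapInv σ (by
    intro w g
    rw [SkewExt.augmentation_smul, mul_comm])

lemma SkewExt.char_single (σ : C₂ →* k) (g : C₂) (w : Lam k c) :
    SkewExt.char σ (SkewMonoidAlgebra.single g w) = ExteriorAlgebra.algebraMapInv w * σ g := by
  simp [SkewExt.char, SkewMonoidAlgebra.liftNCAlgHom, SkewMonoidAlgebra.liftNCRingHom]

/-- The homomorphism from `Λ` to the dual numbers with `v ↦ ℓ(v) ε` on linear elements. -/
def Lam.toDual (ℓ : (Fin c → k) →ₗ[k] k) : Lam k c →ₐ[k] TrivSqZeroExt k k :=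
  ExteriorAlgebra.lift k ⟨(TrivSqZeroExt.inrHom k k).comp ℓ, fun v => by simp⟩

lemma Lam.toDual_ι (ℓ : (Fin c → k) →ₗ[k] k) (v : Fin c → k) :
    Lam.toDual ℓ (ExteriorAlgebra.ι k v) = TrivSqZeroExt.inr (ℓ v) := by
  simp [Lam.toDual]

lemma Lam.fst_toDual (ℓ : (Fin c → k) →ₗ[k] k) (w : Lam k c) :
    (Lam.toDual ℓ w).fst = ExteriorAlgebra.algebraMapInv w := by
  have h : (TrivSqZeroExt.fstHom k k k).comp (Lam.toDual ℓ) = ExteriorAlgebra.algebraMapInv := by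
    apply ExteriorAlgebra.hom_ext
    ext i
    simp [Lam.toDual_ι, ExteriorAlgebra.algebraMapInv]
  exact DFunLike.congr_fun h w

/-- The action of `C₂` on the dual numbers with `ε ↦ -ε`. -/
def C₂.conj (g : C₂) : TrivSqZeroExt k k →ₐ[k] TrivSqZeroExt k k :=
  TrivSqZeroExt.map (C₂.sgn k g • LinearMap.id)

lemma C₂.fst_conj (g : C₂) (z : TrivSqZeroExt k k) : (C₂.conj g z).fst = z.fst := by
  simp [C₂.conj]

lemma C₂.snd_conj (g : C₂) (z : TrivSqZeroExt k k) :
    (C₂.conj g z).snd = C₂.sgn k g * z.snd := by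
  simp [C₂.conj]

/-- Both sides are algebra homomorphisms in `w`, so it suffices to compare them on linear elements.
This equivariance is what lets the action of `Λ` extend to `A`. -/
lemma Lam.toDual_smul (ℓ : (Fin c → k) →ₗ[k] k) (g : C₂) (w : Lam k c) :
    Lam.toDual ℓ (g • w) = C₂.conj g (Lam.toDual ℓ w) := by
  have h : (Lam.toDual ℓ).comp (C₂.toAut k c g : Lam k c →ₐ[k] Lam k c) =
      (C₂.conj g).comp (Lam.toDual ℓ) := by
    apply ExteriorAlgebra.hom_ext
    refine LinearMap.ext fun v => ?_
    change Lam.toDual ℓ (g • (ExteriorAlgebra.ι k v : Lam k c)) = C₂.conj g (Lam.toDual ℓ _)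
    rw [Lam.smul_ι, map_smul, Lam.toDual_ι]
    ext
    · simp [C₂.fst_conj]
    · simp [C₂.snd_conj, mul_comm]
  exact DFunLike.congr_fun h w

/-- The action of `C₂` on the dual numbers, twisted by a character. -/
def C₂.twistedConj (σ : C₂ →* k) : C₂ →* Module.End k (TrivSqZeroExt k k) where
  toFun g := σ g • (C₂.conj g).toLinearMap
  map_one' := by
    ext z <;> simp [C₂.fst_conj, C₂.snd_conj]
  map_mul' a b := by
    ext z <;> simp [C₂.fst_conj, C₂.snd_conj] <;> ring

/-- The representation of `A` on the dual numbers where `Λ` acts through `Lam.toDual ℓ` and `C₂`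
by conjugation twisted with `σ`. -/
def SkewExt.rho (σ : C₂ →* k) (ℓ : (Fin c → k) →ₗ[k] k) :
    SkewExt k c →ₐ[k] Module.End k (TrivSqZeroExt k k) :=
  SkewMonoidAlgebra.liftNCAlgHom ((Algebra.lmul k (TrivSqZeroExt k k)).comp (Lam.toDual ℓ))
    (C₂.twistedConj σ) (by
      intro w g
      refine LinearMap.ext fun z => ?_
      simp [C₂.twistedConj, Lam.toDual_smul])

lemma SkewExt.rho_single (σ : C₂ →* k) (ℓ : (Fin c → k) →ₗ[k] k) (g : C₂) (w : Lam k c)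
    (z : TrivSqZeroExt k k) :
    SkewExt.rho σ ℓ (SkewMonoidAlgebra.single g w) z = Lam.toDual ℓ w * (σ g • C₂.conj g z) := by
  simp [SkewExt.rho, SkewMonoidAlgebra.liftNCAlgHom, SkewMonoidAlgebra.liftNCRingHom,
    C₂.twistedConj]

lemma SkewExt.fst_rho (σ : C₂ →* k) (ℓ : (Fin c → k) →ₗ[k] k) (r : SkewExt k c)
    (z : TrivSqZeroExt k k) : (SkewExt.rho σ ℓ r z).fst = SkewExt.char σ r * z.fst := by
  induction r using SkewMonoidAlgebra.induction_on with
  | zero => simp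
  | single g w =>
    rw [SkewExt.rho_single, SkewExt.char_single, TrivSqZeroExt.fst_mul, Lam.fst_toDual,
      TrivSqZeroExt.fst_smul, C₂.fst_conj, smul_eq_mul, mul_assoc]
  | add a b ha hb => simp [ha, hb, add_mul]

/-- Conjugation negates `ε`, so the submodule carries the character of the top times the sign. This
is why two extensions must be spliced to return to the trivial module. -/
lemma SkewExt.rho_inr (σ σ' : C₂ →* k) (h : σ' = σ * C₂.sgn k) (ℓ : (Fin c → k) →ₗ[k] k)
    (r : SkewExt k c) (b : k) :
    SkewExt.rho σ ℓ r (TrivSqZeroExt.inr b) = TrivSqZeroExt.inr (SkewExt.char σ' r * b) := by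
  subst h
  induction r using SkewMonoidAlgebra.induction_on with
  | zero => simp
  | single g w =>
    rw [SkewExt.rho_single, SkewExt.char_single]
    ext
    · simp [C₂.fst_conj]
    · simp [C₂.fst_conj, C₂.snd_conj, Lam.fst_toDual]
      ring
  | add a b ha hb =>
    rw [map_add, LinearMap.add_apply, ha, hb, map_add, add_mul, TrivSqZeroExt.inr_add]

variable (c) in
/-- The one-dimensional `A`-module given by the character `SkewExt.char σ`. -/
def SkewExt.oneDim (σ : C₂ →* k) : ModuleCat.{u} (SkewExt k c) :=
  (ModuleCat.restrictScalars (SkewExt.char σ).toRingHom).obj (ModuleCat.of k k)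

/-- The dual numbers as an `A`-module through `SkewExt.rho σ ℓ`. -/
def SkewExt.twoDim (σ : C₂ →* k) (ℓ : (Fin c → k) →ₗ[k] k) : ModuleCat.{u} (SkewExt k c) :=
  (ModuleCat.restrictScalars (SkewExt.rho σ ℓ).toRingHom).obj
    (ModuleCat.of (Module.End k (TrivSqZeroExt k k)) (TrivSqZeroExt k k))

/-- The projection of the two-dimensional module to its quotient by `ε`. -/
def SkewExt.proj (σ : C₂ →* k) (ℓ : (Fin c → k) →ₗ[k] k) :
    SkewExt.twoDim σ ℓ ⟶ SkewExt.oneDim c σ :=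
  ModuleCat.ofHom (X := SkewExt.twoDim σ ℓ) (Y := SkewExt.oneDim c σ)
    { toFun := fun z : TrivSqZeroExt k k => (z.fst : k)
      map_add' := fun _ _ => rfl
      map_smul' := fun r z => SkewExt.fst_rho σ ℓ r z }

/-- The inclusion of the line spanned by `ε` into the two-dimensional module. -/
def SkewExt.incl (σ σ' : C₂ →* k) (h : σ' = σ * C₂.sgn k) (ℓ : (Fin c → k) →ₗ[k] k) :
    SkewExt.oneDim c σ' ⟶ SkewExt.twoDim σ ℓ :=
  ModuleCat.ofHom (X := SkewExt.oneDim c σ') (Y := SkewExt.twoDim σ ℓ)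
    { toFun := fun b : k => (TrivSqZeroExt.inr b : TrivSqZeroExt k k)
      map_add' := fun a b => TrivSqZeroExt.inr_add k a b
      map_smul' := fun r z => (SkewExt.rho_inr σ σ' h ℓ r z).symm }

lemma SkewExt.incl_proj (σ σ' : C₂ →* k) (h : σ' = σ * C₂.sgn k) (ℓ : (Fin c → k) →ₗ[k] k) :
    SkewExt.incl σ σ' h ℓ ≫ SkewExt.proj σ ℓ = 0 := by
  ext (b : k)
  exact TrivSqZeroExt.fst_inr k b

lemma SkewExt.shortExact (σ σ' : C₂ →* k) (h : σ' = σ * C₂.sgn k) (ℓ : (Fin c → k) →ₗ[k] k) :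
    (ShortComplex.mk _ _ (SkewExt.incl_proj σ σ' h ℓ)).ShortExact := by
  have hm : Mono (SkewExt.incl σ σ' h ℓ) :=
    (ModuleCat.mono_iff_injective _).2 fun a b hab => TrivSqZeroExt.inr_injective hab
  have he : Epi (SkewExt.proj σ ℓ) :=
    (ModuleCat.epi_iff_surjective _).2 fun a : k =>
      ⟨(TrivSqZeroExt.inl a : TrivSqZeroExt k k), TrivSqZeroExt.fst_inl k a⟩
  refine ⟨?_⟩
  rw [ShortComplex.moduleCat_exact_iff]
  intro (z : TrivSqZeroExt k k) (hz : z.fst = 0)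
  refine ⟨(z.snd : k), ?_⟩
  change (TrivSqZeroExt.inr z.snd : TrivSqZeroExt k k) = z
  ext
  · exact hz.symm
  · rfl

lemma SkewExt.u_eq (l : Fin c → k) :
    SkewExt.u k l = SkewMonoidAlgebra.single 1 (ExteriorAlgebra.ι k l) := by
  rw [SkewExt.u]
  congr 1
  simp only [Lam.x, ← map_smul, ← map_sum]
  congr 1
  ext j
  simp [Finset.sum_apply, Pi.single_apply]

lemma SkewExt.char_u (σ : C₂ →* k) (l : Fin c → k) : SkewExt.char σ (SkewExt.u k l) = 0 := by
  rw [SkewExt.u_eq, SkewExt.char_single]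
  simp [ExteriorAlgebra.algebraMapInv]

/-- Everything about restriction to `k[u_λ]` depends on `ℓ` only through the scalar `ℓ l` appearing
here. -/
lemma SkewExt.rho_u (σ : C₂ →* k) (ℓ : (Fin c → k) →ₗ[k] k) (l : Fin c → k)
    (z : TrivSqZeroExt k k) :
    SkewExt.rho σ ℓ (SkewExt.u k l) z = TrivSqZeroExt.inr (ℓ l * z.fst) := by
  rw [SkewExt.u_eq, SkewExt.rho_single, Lam.toDual_ι]
  ext
  · simp
  · simp [C₂.fst_conj, mul_comm]

end Modules

/-! ### Restriction to the subalgebra generated by a linear element -/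

section Restriction

/-- An additive map between modules over the subalgebra generated by `a` is linear if it commutes
with scalars and with `a`. -/
lemma Algebra.map_adjoin_singleton_smul {R A M N : Type*} [CommRing R] [Ring A] [Algebra R A]
    {a : A} [AddCommGroup M] [AddCommGroup N] [Module (Algebra.adjoin R {a}) M]
    [Module (Algebra.adjoin R {a}) N] (f : M →+ N)
    (hR : ∀ (r : R) (m : M), f (algebraMap R (Algebra.adjoin R {a}) r • m) =
      algebraMap R (Algebra.adjoin R {a}) r • f m)
    (ha : ∀ m : M, f ((⟨a, Algebra.self_mem_adjoin_singleton R a⟩ : Algebra.adjoin R {a}) • m) =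
      (⟨a, Algebra.self_mem_adjoin_singleton R a⟩ : Algebra.adjoin R {a}) • f m)
    (b : Algebra.adjoin R {a}) (m : M) : f (b • m) = b • f m := by
  obtain ⟨b, hb⟩ := b
  induction hb using Algebra.adjoin_induction generalizing m with
  | mem x hx =>
    obtain rfl : x = a := hx
    exact ha m
  | algebraMap r => exact hR r m
  | add x y hx hy ihx ihy =>
    have h : (⟨x + y, add_mem hx hy⟩ : Algebra.adjoin R {a}) = ⟨x, hx⟩ + ⟨y, hy⟩ := rfl
    rw [h, add_smul, add_smul, map_add, ihx, ihy]
  | mul x y hx hy ihx ihy =>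
    have h : (⟨x * y, mul_mem hx hy⟩ : Algebra.adjoin R {a}) = ⟨x, hx⟩ * ⟨y, hy⟩ := rfl
    rw [h, mul_smul, mul_smul, ihx, ihy]

variable {k : Type u} [Field k] {c : ℕ}

/-- The element `u_λ` of `k[u_λ]`. -/
def SkewExt.kuGen (l : Fin c → k) : SkewExt.ku k l :=
  ⟨SkewExt.u k l, Algebra.self_mem_adjoin_singleton k _⟩

/-- A homomorphism of `k[u_λ]`-modules from an additive map commuting with `k` and `u_λ`. -/
def SkewExt.kuHom (l : Fin c → k) {M N : ModuleCat.{u} (SkewExt.ku k l)} (f : M →+ N)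
    (hk : ∀ (r : k) (m : M), f (algebraMap k (SkewExt.ku k l) r • m) =
      algebraMap k (SkewExt.ku k l) r • f m)
    (hu : ∀ m : M, f (SkewExt.kuGen l • m) = SkewExt.kuGen l • f m) : M ⟶ N :=
  ModuleCat.ofHom
    { toFun := f
      map_add' := f.map_add
      map_smul' := Algebra.map_adjoin_singleton_smul f hk hu }

/-- The two-dimensional module restricted to `k[u_λ]`. -/
def SkewExt.resTwoDim (l : Fin c → k) (σ : C₂ →* k) (ℓ : (Fin c → k) →ₗ[k] k) :
    ModuleCat.{u} (SkewExt.ku k l) :=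
  (SkewExt.res k l).obj (SkewExt.twoDim σ ℓ)

/-- The one-dimensional module restricted to `k[u_λ]`. -/
def SkewExt.resOneDim (l : Fin c → k) (σ : C₂ →* k) : ModuleCat.{u} (SkewExt.ku k l) :=
  (SkewExt.res k l).obj (SkewExt.oneDim c σ)

/-- The element of the restricted two-dimensional module given by a dual number. -/
def SkewExt.toResTwoDim (l : Fin c → k) (σ : C₂ →* k) (ℓ : (Fin c → k) →ₗ[k] k) :
    TrivSqZeroExt k k ≃+ SkewExt.resTwoDim l σ ℓ :=
  AddEquiv.refl _

/-- The element of the restricted one-dimensional module given by a scalar. -/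
def SkewExt.toResOneDim (l : Fin c → k) (σ : C₂ →* k) : k ≃+ SkewExt.resOneDim l σ :=
  AddEquiv.refl _

/-! ### Splitting and freeness of the restricted modules -/

section

variable (l : Fin c → k) (σ σ' : C₂ →* k) (ℓ : (Fin c → k) →ₗ[k] k)

lemma SkewExt.algebraMap_smul_toResTwoDim (r : k) (z : TrivSqZeroExt k k) :
    algebraMap k (SkewExt.ku k l) r • SkewExt.toResTwoDim l σ ℓ z =
      SkewExt.toResTwoDim l σ ℓ (r • z) := by
  change SkewExt.rho σ ℓ (algebraMap k (SkewExt k c) r) z = r • z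
  rw [AlgHom.commutes, Module.algebraMap_end_apply]

lemma SkewExt.kuGen_smul_toResTwoDim (z : TrivSqZeroExt k k) :
    SkewExt.kuGen l • SkewExt.toResTwoDim l σ ℓ z =
      SkewExt.toResTwoDim l σ ℓ (TrivSqZeroExt.inr (ℓ l * z.fst)) :=
  SkewExt.rho_u σ ℓ l z

lemma SkewExt.algebraMap_smul_toResOneDim (r z : k) :
    algebraMap k (SkewExt.ku k l) r • SkewExt.toResOneDim l σ z =
      SkewExt.toResOneDim l σ (r * z) := by
  change SkewExt.char σ (algebraMap k (SkewExt k c) r) * z = r * z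
  rw [AlgHom.commutes, Algebra.algebraMap_self_apply]

lemma SkewExt.kuGen_smul_resOneDim (z : SkewExt.resOneDim l σ) : SkewExt.kuGen l • z = 0 := by
  change SkewExt.char σ (SkewExt.u k l) * (show k from z) = (0 : k)
  rw [SkewExt.char_u, zero_mul]

variable {ℓ}

/-- Here `u_λ` acts as zero on the dual numbers, so the scalar inclusion `inl` is already linear
over `k[u_λ]`. -/
lemma SkewExt.exists_section_of_eq_zero (h : ℓ l = 0) :
    ∃ s : SkewExt.resOneDim l σ ⟶ SkewExt.resTwoDim l σ ℓ,
      s ≫ (SkewExt.res k l).map (SkewExt.proj σ ℓ) = 𝟙 _ := by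
  refine ⟨SkewExt.kuHom l (((SkewExt.toResTwoDim l σ ℓ).toAddMonoidHom.comp
    (TrivSqZeroExt.inlHom k k).toAddMonoidHom).comp
      (SkewExt.toResOneDim l σ).symm.toAddMonoidHom) ?_ ?_, ?_⟩
  · intro r m
    obtain ⟨z, rfl⟩ := (SkewExt.toResOneDim l σ).surjective m
    rw [SkewExt.algebraMap_smul_toResOneDim]
    change SkewExt.toResTwoDim l σ ℓ (TrivSqZeroExt.inl (r * z)) =
      _ • SkewExt.toResTwoDim l σ ℓ (TrivSqZeroExt.inl z)
    rw [SkewExt.algebraMap_smul_toResTwoDim]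
    congr 1
    ext <;> simp
  · intro m
    obtain ⟨z, rfl⟩ := (SkewExt.toResOneDim l σ).surjective m
    rw [SkewExt.kuGen_smul_resOneDim, map_zero]
    change _ = SkewExt.kuGen l • SkewExt.toResTwoDim l σ ℓ (TrivSqZeroExt.inl z)
    rw [SkewExt.kuGen_smul_toResTwoDim, h, zero_mul, TrivSqZeroExt.inr_zero, map_zero]
  · ext (z : k)
    exact TrivSqZeroExt.fst_inl k z

/-- When `ℓ l ≠ 0`, the line of `ε` is the image of `u_λ`, while `u_λ` kills the one-dimensional
target. -/
lemma SkewExt.incl_comp_eq_zero (h : σ' = σ * C₂.sgn k) (hl : ℓ l ≠ 0)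
    (a : SkewExt.resTwoDim l σ ℓ ⟶ SkewExt.resOneDim l σ') :
    (SkewExt.res k l).map (SkewExt.incl σ σ' h ℓ) ≫ a = 0 := by
  ext (z : k)
  have hz : SkewExt.toResTwoDim l σ ℓ (TrivSqZeroExt.inr z) =
      SkewExt.kuGen l • SkewExt.toResTwoDim l σ ℓ (TrivSqZeroExt.inl ((ℓ l)⁻¹ * z)) := by
    rw [SkewExt.kuGen_smul_toResTwoDim, TrivSqZeroExt.fst_inl, mul_inv_cancel_left₀ hl]
  change a.hom (SkewExt.toResTwoDim l σ ℓ (TrivSqZeroExt.inr z)) = 0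
  rw [hz, map_smul, SkewExt.kuGen_smul_resOneDim]

lemma SkewExt.kuGen_mul_self : SkewExt.kuGen l * SkewExt.kuGen l = 0 := by
  apply Subtype.ext
  change SkewExt.u k l * SkewExt.u k l = 0
  rw [SkewExt.u_eq, SkewMonoidAlgebra.single_mul_single, one_smul, ExteriorAlgebra.ι_sq_zero,
    SkewMonoidAlgebra.single_zero]

lemma SkewExt.smul_toResTwoDim_inl_one (hl : ℓ l ≠ 0) (z : TrivSqZeroExt k k) :
    algebraMap k (SkewExt.ku k l) z.fst • SkewExt.toResTwoDim l σ ℓ (TrivSqZeroExt.inl 1) +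
      algebraMap k (SkewExt.ku k l) (z.snd * (ℓ l)⁻¹) • SkewExt.kuGen l •
        SkewExt.toResTwoDim l σ ℓ (TrivSqZeroExt.inl 1) = SkewExt.toResTwoDim l σ ℓ z := by
  rw [SkewExt.kuGen_smul_toResTwoDim, SkewExt.algebraMap_smul_toResTwoDim,
    SkewExt.algebraMap_smul_toResTwoDim, ← map_add]
  congr 1
  ext
  · simp
  · simp [hl]

lemma SkewExt.hom_smul_add_smul_smul {M N : ModuleCat.{u} (SkewExt.ku k l)} (f : M ⟶ N)
    (a b d : SkewExt.ku k l) (m : M) :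
    f.hom (a • m + b • d • m) = a • f.hom m + b • d • f.hom m := by
  rw [LinearMap.map_add, LinearMap.map_smul, LinearMap.map_smul, LinearMap.map_smul]

/-- Freeness on the generator `1`: since `ε = (ℓ l)⁻¹ u_λ · 1`, the image `m` of `1` determines the
map, and `u_λ² = 0` makes any choice of `m` admissible. -/
lemma SkewExt.exists_hom_resTwoDim (hl : ℓ l ≠ 0) {M : ModuleCat.{u} (SkewExt.ku k l)} (m : M) :
    ∃ F : SkewExt.resTwoDim l σ ℓ ⟶ M, ∀ z, F.hom (SkewExt.toResTwoDim l σ ℓ z) =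
      algebraMap k (SkewExt.ku k l) z.fst • m +
        algebraMap k (SkewExt.ku k l) (z.snd * (ℓ l)⁻¹) • SkewExt.kuGen l • m := by
  have hcomm : ∀ (r : k) (x : M), SkewExt.kuGen l • algebraMap k (SkewExt.ku k l) r • x =
      algebraMap k (SkewExt.ku k l) r • SkewExt.kuGen l • x := fun r x => by
    rw [smul_smul, smul_smul, Algebra.commutes]
  have hmul : ∀ (r s : k) (x : M), algebraMap k (SkewExt.ku k l) r •
      algebraMap k (SkewExt.ku k l) s • x = algebraMap k (SkewExt.ku k l) (r * s) • x :=
    fun r s x => by rw [smul_smul, map_mul]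
  have huu : SkewExt.kuGen l • SkewExt.kuGen l • m = 0 := by
    rw [smul_smul, SkewExt.kuGen_mul_self, zero_smul]
  let F : SkewExt.resTwoDim l σ ℓ →+ M :=
    AddMonoidHom.comp
      { toFun := fun z : TrivSqZeroExt k k => algebraMap k (SkewExt.ku k l) z.fst • m +
          algebraMap k (SkewExt.ku k l) (z.snd * (ℓ l)⁻¹) • SkewExt.kuGen l • m
        map_zero' := by simp
        map_add' := fun y z => by
          simp only [TrivSqZeroExt.fst_add, TrivSqZeroExt.snd_add, add_mul, map_add, add_smul]
          abel }
      (SkewExt.toResTwoDim l σ ℓ).symm.toAddMonoidHom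
  have hF : ∀ z, F (SkewExt.toResTwoDim l σ ℓ z) = algebraMap k (SkewExt.ku k l) z.fst • m +
      algebraMap k (SkewExt.ku k l) (z.snd * (ℓ l)⁻¹) • SkewExt.kuGen l • m := fun _ => rfl
  refine ⟨SkewExt.kuHom l F ?_ ?_, hF⟩
  · intro r x
    obtain ⟨z, rfl⟩ := (SkewExt.toResTwoDim l σ ℓ).surjective x
    rw [SkewExt.algebraMap_smul_toResTwoDim, hF, hF, smul_add, hmul, hmul,
      TrivSqZeroExt.fst_smul, TrivSqZeroExt.snd_smul, smul_eq_mul, smul_eq_mul, mul_assoc]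
  · intro x
    obtain ⟨z, rfl⟩ := (SkewExt.toResTwoDim l σ ℓ).surjective x
    rw [SkewExt.kuGen_smul_toResTwoDim, hF, hF, smul_add, hcomm, hcomm, huu, smul_zero,
      add_zero, TrivSqZeroExt.fst_inr, TrivSqZeroExt.snd_inr, map_zero, zero_smul, zero_add,
      mul_comm (ℓ l), mul_assoc, mul_inv_cancel₀ hl, mul_one]

lemma SkewExt.projective_resTwoDim (hl : ℓ l ≠ 0) : Projective (SkewExt.resTwoDim l σ ℓ) := by
  refine ⟨fun {M N} f e he => ?_⟩
  obtain ⟨m, hm⟩ := (ModuleCat.epi_iff_surjective e).1 he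
    (f.hom (SkewExt.toResTwoDim l σ ℓ (TrivSqZeroExt.inl 1)))
  have hm' : e.hom m = f.hom (SkewExt.toResTwoDim l σ ℓ (TrivSqZeroExt.inl 1)) := hm
  obtain ⟨F, hF⟩ := SkewExt.exists_hom_resTwoDim l σ hl m
  refine ⟨F, ModuleCat.hom_ext (LinearMap.ext fun x => ?_)⟩
  obtain ⟨z, rfl⟩ := (SkewExt.toResTwoDim l σ ℓ).surjective x
  change e.hom (F.hom (SkewExt.toResTwoDim l σ ℓ z)) = f.hom (SkewExt.toResTwoDim l σ ℓ z)
  rw [hF, SkewExt.hom_smul_add_smul_smul, hm', ← SkewExt.hom_smul_add_smul_smul,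
    SkewExt.smul_toResTwoDim_inl_one l σ hl]

/-- By linearity over `k`, an endomorphism is multiplication by its value `t` at `1`. -/
lemma SkewExt.isIso_of_ne_zero (a : SkewExt.resOneDim l σ ⟶ SkewExt.resOneDim l σ) (ha : a ≠ 0) :
    IsIso a := by
  have key : ∀ z : k, a.hom (SkewExt.toResOneDim l σ z) =
      SkewExt.toResOneDim l σ (z * (SkewExt.toResOneDim l σ).symm
        (a.hom (SkewExt.toResOneDim l σ 1))) := by
    intro z
    rw [← SkewExt.algebraMap_smul_toResOneDim, AddEquiv.apply_symm_apply, ← map_smul,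
      SkewExt.algebraMap_smul_toResOneDim, mul_one]
  set t : k := (SkewExt.toResOneDim l σ).symm (a.hom (SkewExt.toResOneDim l σ 1))
  have ht : t ≠ 0 := by
    intro ht
    apply ha
    ext x
    obtain ⟨z, rfl⟩ := (SkewExt.toResOneDim l σ).surjective x
    change a.hom _ = 0
    rw [key, ht, mul_zero, map_zero]
  rw [ConcreteCategory.isIso_iff_bijective]
  constructor
  · intro x y hxy
    obtain ⟨x, rfl⟩ := (SkewExt.toResOneDim l σ).surjective x
    obtain ⟨y, rfl⟩ := (SkewExt.toResOneDim l σ).surjective y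
    have hxy' : a.hom (SkewExt.toResOneDim l σ x) = a.hom (SkewExt.toResOneDim l σ y) := hxy
    rw [key, key] at hxy'
    rw [mul_right_cancel₀ ht ((SkewExt.toResOneDim l σ).injective hxy')]
  · intro y
    obtain ⟨y, rfl⟩ := (SkewExt.toResOneDim l σ).surjective y
    refine ⟨SkewExt.toResOneDim l σ (y * t⁻¹), ?_⟩
    change a.hom _ = _
    rw [key, inv_mul_cancel_right₀ ht]

lemma SkewExt.id_resOneDim_ne_zero : 𝟙 (SkewExt.resOneDim l σ) ≠ 0 := by
  intro h
  have h1 := ConcreteCategory.congr_hom h (SkewExt.toResOneDim l σ 1)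
  exact one_ne_zero (α := k) h1

end

/-- The class in `Ext²_A(k, k)` that is the square of the linear form `ℓ`. -/
def SkewExt.squareClass (ℓ : (Fin c → k) →ₗ[k] k) :
    Ext (SkewExt.oneDim c (1 : C₂ →* k)) (SkewExt.oneDim c 1) 2 :=
  twoStepClass (SkewExt.shortExact 1 (C₂.sgn k) (one_mul _).symm ℓ)
    (SkewExt.shortExact (C₂.sgn k) 1 (C₂.sgn_mul_self k).symm ℓ)

/-! ### Restricting the square classes; primality of the kernel -/

lemma SkewExt.res_squareClass_eq_zero (l : Fin c → k) (ℓ : (Fin c → k) →ₗ[k] k) (h : ℓ l = 0) :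
    (SkewExt.squareClass ℓ).mapExactFunctor (SkewExt.res k l) = 0 := by
  rw [SkewExt.squareClass, map_twoStepClass]
  obtain ⟨s, hs⟩ := SkewExt.exists_section_of_eq_zero l 1 h
  exact twoStepClass_eq_zero_of_section _ _ s hs

lemma SkewExt.res_squareClass_ne_zero (l : Fin c → k) (ℓ : (Fin c → k) →ₗ[k] k) (h : ℓ l ≠ 0) :
    (SkewExt.squareClass ℓ).mapExactFunctor (SkewExt.res k l) ≠ 0 := by
  rw [SkewExt.squareClass, map_twoStepClass]
  exact twoStepClass_ne_zero _ _ (SkewExt.projective_resTwoDim l 1 h)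
    (SkewExt.projective_resTwoDim l (C₂.sgn k) h)
    (SkewExt.incl_comp_eq_zero l _ _ (C₂.sgn_mul_self k).symm h)
    (SkewExt.id_resOneDim_ne_zero l 1)

lemma SkewExt.evenExt_res_mul_ne_zero (l : Fin c → k) (hl : l ≠ 0)
    {x y : EvenExt (SkewExt.resOneDim l 1)} (hx : x ≠ 0) (hy : y ≠ 0) : x * y ≠ 0 := by
  -- Any form with `ℓ l ≠ 0` supplies the periodicity; a coordinate at which `l` is nonzero will do.
  obtain ⟨i, hi⟩ := Function.ne_iff.1 hl
  let ℓ : (Fin c → k) →ₗ[k] k := LinearMap.proj i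
  have h : ℓ l ≠ 0 := hi
  exact EvenExt.mul_ne_zero_of_twoStep
    ((SkewExt.shortExact 1 (C₂.sgn k) (one_mul _).symm ℓ).map_of_exact (SkewExt.res k l))
    ((SkewExt.shortExact (C₂.sgn k) 1 (C₂.sgn_mul_self k).symm ℓ).map_of_exact (SkewExt.res k l))
    (SkewExt.projective_resTwoDim l 1 h) (SkewExt.projective_resTwoDim l (C₂.sgn k) h)
    (SkewExt.incl_comp_eq_zero l _ _ (C₂.sgn_mul_self k).symm h) (SkewExt.isIso_of_ne_zero l 1) hx hy

/-- The element of degree one of `Ext^{2*}_A(k, k)` that is the square of the linear form `ℓ`. -/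
def SkewExt.square (ℓ : (Fin c → k) →ₗ[k] k) : EvenExt (SkewExt.triv k c) :=
  DirectSum.of (EvenExtPiece (SkewExt.triv k c)) 1 (SkewExt.squareClass ℓ)

lemma SkewExt.square_mem_ker_tau_iff (l : Fin c → k) (ℓ : (Fin c → k) →ₗ[k] k) :
    SkewExt.square ℓ ∈ RingHom.ker (SkewExt.tau k l) ↔ ℓ l = 0 := by
  refine (EvenExt.of_mem_ker_map_iff (SkewExt.res k l) (SkewExt.triv k c) 1
    (SkewExt.squareClass ℓ)).trans ⟨fun h => ?_, SkewExt.res_squareClass_eq_zero l ℓ⟩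
  by_contra hl
  exact SkewExt.res_squareClass_ne_zero l ℓ hl h

lemma SkewExt.ker_tau_isPrime (l : Fin c → k) (hl : l ≠ 0) :
    (RingHom.ker (SkewExt.tau k l)).IsPrime := by
  constructor
  · obtain ⟨i, hi⟩ := Function.ne_iff.1 hl
    intro h
    have h1 : SkewExt.square (LinearMap.proj i) ∈ RingHom.ker (SkewExt.tau k l) :=
      h ▸ Submodule.mem_top
    exact hi ((SkewExt.square_mem_ker_tau_iff l _).1 h1)
  · intro x y hxy
    by_contra! hn
    simp only [RingHom.mem_ker] at hxy hn
    rw [map_mul] at hxy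
    exact SkewExt.evenExt_res_mul_ne_zero l hl hn.1 hn.2 hxy

/-! ### The kernel determines the line spanned by the tuple, and conversely -/

lemma SkewExt.u_smul (a : k) (l : Fin c → k) : SkewExt.u k (a • l) = a • SkewExt.u k l := by
  rw [SkewExt.u_eq, SkewExt.u_eq, map_smul, SkewMonoidAlgebra.smul_single]

lemma SkewExt.ku_smul {a : k} (ha : a ≠ 0) (l : Fin c → k) :
    SkewExt.ku k (a • l) = SkewExt.ku k l := by
  apply le_antisymm <;> refine Algebra.adjoin_le (Set.singleton_subset_iff.2 ?_)
  · rw [SkewExt.u_smul]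
    exact Subalgebra.smul_mem _ (Algebra.self_mem_adjoin_singleton k _) a
  · have h : SkewExt.u k l = a⁻¹ • SkewExt.u k (a • l) := by
      rw [SkewExt.u_smul, smul_smul, inv_mul_cancel₀ ha, one_smul]
    rw [h]
    exact Subalgebra.smul_mem _ (Algebra.self_mem_adjoin_singleton k _) _

/-- Restriction of `A`-modules to a subalgebra. -/
abbrev SkewExt.resSub (B : Subalgebra k (SkewExt k c)) :
    ModuleCat.{u} (SkewExt k c) ⥤ ModuleCat.{u} B :=
  ModuleCat.restrictScalars B.val.toRingHom

instance (B : Subalgebra k (SkewExt k c)) : PreservesFiniteLimits (SkewExt.resSub B) where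
  preservesFiniteLimits _ := { preservesLimit := inferInstance }

instance (B : Subalgebra k (SkewExt k c)) : PreservesFiniteColimits (SkewExt.resSub B) where
  preservesFiniteColimits _ := { preservesColimit := inferInstance }

/-- The target rings for `B` and `B'` are different types, but the kernels are ideals of one ring;
stating this for arbitrary subalgebras allows the equality to be substituted. -/
lemma SkewExt.ker_map_resSub_congr {B B' : Subalgebra k (SkewExt k c)} (h : B = B') :
    RingHom.ker (EvenExt.map (SkewExt.resSub B) (SkewExt.triv k c)) =
      RingHom.ker (EvenExt.map (SkewExt.resSub B') (SkewExt.triv k c)) := by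
  subst h
  rfl

lemma SkewExt.ker_tau_smul {a : k} (ha : a ≠ 0) (l : Fin c → k) :
    RingHom.ker (SkewExt.tau k (a • l)) = RingHom.ker (SkewExt.tau k l) :=
  SkewExt.ker_map_resSub_congr (SkewExt.ku_smul ha l)

lemma SkewExt.exists_smul_of_ker_tau_eq {l m : Fin c → k}
    (h : RingHom.ker (SkewExt.tau k l) = RingHom.ker (SkewExt.tau k m)) : ∃ a : k, m = a • l := by
  by_contra hn
  have hm : m ∉ Submodule.span k {l} := fun hm =>
    let ⟨a, ha⟩ := Submodule.mem_span_singleton.1 hm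
    hn ⟨a, ha.symm⟩
  -- A form vanishing on `l` but not at `m`: its square lies in the first kernel and not in the
  -- second.
  obtain ⟨ℓ, hℓ, hle⟩ := Submodule.exists_le_ker_of_notMem hm
  have h1 : SkewExt.square ℓ ∈ RingHom.ker (SkewExt.tau k l) :=
    (SkewExt.square_mem_ker_tau_iff l ℓ).2 (hle (Submodule.mem_span_singleton_self l))
  rw [h] at h1
  exact hℓ ((SkewExt.square_mem_ker_tau_iff m ℓ).1 h1)

end Restriction

end

theorem mainTheorem11 {k : Type u} [Field k] (hk : ringChar k ≠ 2) (c : ℕ) :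
    (∀ l : Fin c → k, l ≠ 0 →
      (RingHom.ker (SkewExt.tau k l)).IsHomogeneous (EvenExt.grading (SkewExt.triv k c)) ∧
      (RingHom.ker (SkewExt.tau k l)).IsPrime ∧
      RingHom.ker (SkewExt.tau k l) ≠
        (HomogeneousIdeal.irrelevant (EvenExt.grading (SkewExt.triv k c))).toIdeal) ∧
    (∀ l m : Fin c → k, l ≠ 0 → m ≠ 0 →
      (RingHom.ker (SkewExt.tau k l) = RingHom.ker (SkewExt.tau k m) ↔
        ∃ a : k, m = a • l)) := by
  refine ⟨fun l hl => ⟨EvenExt.ker_map_isHomogeneous (SkewExt.res k l) (SkewExt.triv k c),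
    SkewExt.ker_tau_isPrime l hl, fun h => ?_⟩,
    fun l m hl hm => ⟨SkewExt.exists_smul_of_ker_tau_eq, ?_⟩⟩
  · obtain ⟨i, hi⟩ := Function.ne_iff.1 hl
    have h1 : SkewExt.square (LinearMap.proj i) ∈ RingHom.ker (SkewExt.tau k l) :=
      h ▸ EvenExt.of_mem_irrelevant (SkewExt.triv k c) one_ne_zero
        (SkewExt.squareClass (LinearMap.proj i))
    exact hi ((SkewExt.square_mem_ker_tau_iff l _).1 h1)
  · rintro ⟨a, rfl⟩
    have ha : a ≠ 0 := fun ha => hm (by rw [ha, zero_smul])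
    exact (SkewExt.ker_tau_smul ha l).symm
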